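/- **System.** There are $n=3f+1$ processes, at most $f$ of which are Byzantine (behave arbitrarily); the others are correct. A quorum is a set of $2f+1$ processes. Messages and certificates are signed and signatures of correct processes cannot be forged; the hash function $\mathsf{hash}$ is collision-free (injective). The network is asynchronous: messages may be lost, delayed, duplicated and reordered. A synchronizer tells processes which view $v=1,2,\dots$ to enter; each process enters views in increasing order. View $v$ has leader $\mathsf{leader}(v)=p_{((v-1)\bmod n)+1}$, and the leader of $v$ fills log positions $(v-1)B+1,\dots,vB$, where $B$ is fixed. There is a special value $\mathtt{nop}$ and an application predicate $\mathsf{valid}$. **Certificates.** A set $C$ is a *prepared* (resp. *commit*) *certificate* for $(v,k,h)$, written $\mathsf{prepared}(C,v,k,h)$ (resp. $\mathsf{committed}(C,v,k,h)$), if $C=\{\langle \mathtt{PREPARE}(v,k,h)\rangle_j \mid p_j\in Q\}$ (resp. with $\mathtt{COMMIT}$) for a quorum $Q$. $C$ is *well-formed*, $\mathsf{wf}(C)$, if every message in it signed by a correct process was sent by that process. **The HotStuff-light protocol.** Each process keeps $\mathsf{curr\_view}$, a status (initializing, normal, advanced), $\mathsf{last\_delivered}$ (initially $0$), a queue of values,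 and, for each position $k\ge1$, the entries $\mathsf{log}[k]$, $\mathsf{prep\_log}[k]$, $\mathsf{commit\_log}[k]$ (initially $\bot$), $\mathsf{prep\_view}[k]$, $\mathsf{lock\_view}[k]$ (initially $0$), a certificate $\mathsf{cert}[k]$, and $\mathsf{phase}[k]$ (initially START). A correct process $p_i$ acts as follows. - *Timers.* When its delivery or recovery timer expires, $p_i$ stops all timers, asks the synchronizer to advance, and sets its status to advanced. Timers may expire at any time while running. - *Proposing.* Processes broadcast valid values, and a received valid value that is neither queued nor delivered is appended to the queue. In normal status, the leader of the current view proposes the first value $x$ of its queue not in its log at its next slot $\mathsf{next}\le \mathsf{curr\_view}\cdot B$ by sending $\mathtt{PREPREPARE}(\mathsf{curr\_view},\mathsf{next},x)$ to all and incrementing $\mathsf{next}$; when its broadcast timer expires it proposes $\mathtt{nop}$ instead. - *Entering view $v$.* Set $\mathsf{curr\_view}\leftarrow v$ and the status to initializing; send $\mathtt{NEW\_LEADER}(v,\mathsf{prep\_view},\mathsf{prep\_log},\mathsf{cert})$ to $\mathsf{leader}(v)$. - *$\mathtt{NEW\_LEADER}$ messages of view $v=\mathsf{curr\_view}$ from a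 quorum, at the initializing leader.* Check for each of them that whenever $\mathit{prep\_view}[k]>0$, we have $\mathit{prep\_view}[k]<v$ and $\mathit{cert}[k]$ is a prepared certificate for $(\mathit{prep\_view}[k],k,\mathsf{hash}(\mathit{prep\_log}[k]))$. For each $k$ for which some prepared view is nonzero, take $(\mathit{log}',\mathit{prep\_view}',\mathit{cert}')[k]$ from a message with the highest $\mathit{prep\_view}[k]$; the other entries are empty. Set $\mathsf{next}\leftarrow(v-1)B+1$ and send $\mathtt{NEW\_STATE}(v,\mathit{log}',\mathit{prep\_view}',\mathit{cert}')$ to all. - *$\mathtt{NEW\_STATE}(v,\mathit{log}',\mathit{prep\_view}',\mathit{cert}')$, $v=\mathsf{curr\_view}$, in initializing status.* Check that the sender is $\mathsf{leader}(v)$; that $\mathit{log}'[k]\ne\bot$ whenever $\mathsf{lock\_view}[k]>0$; and that whenever $\mathit{log}'[k]\neq\bot$, we have $\mathsf{lock\_view}[k]\le\mathit{prep\_view}'[k]<v$ and $\mathit{cert}'[k]$ is a prepared certificate for $(\mathit{prep\_view}'[k],k,\mathsf{hash}(\mathit{log}'[k]))$. Then set $\mathsf{log}\leftarrow\mathit{log}'$,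 except that for $k\le(v-1)B$ set $\mathsf{log}[k]\leftarrow\mathtt{nop}$ if $\mathit{log}'[k]=\bot$ or there is $k'\ne k$ with $\mathit{log}'[k']=\mathit{log}'[k]$ and $\mathit{prep\_view}'[k']>\mathit{prep\_view}'[k]$. If $\mathsf{last\_delivered}\ge vB$, the status becomes advanced. Otherwise, for all $k\le(v-1)B$ set $\mathsf{phase}[k]\leftarrow$ PREPREPARED and send $\mathtt{PREPARE}(v,k,\mathsf{hash}(\mathsf{log}[k]))$ to all; the status becomes normal. - *Voting,* in normal status with $v=\mathsf{curr\_view}$: - on $\mathtt{PREPREPARE}(v,k,x)$ from $\mathsf{leader}(v)$ with $\mathsf{phase}[k]$ = START and $k\le vB$, where either $x=\mathtt{nop}$, or $\mathsf{valid}(x)$ and $x$ is not in $\mathsf{log}$: set $\mathsf{log}[k]\leftarrow x$, the phase to PREPREPARED, and send $\mathtt{PREPARE}(v,k,\mathsf{hash}(x))$ to all; - on a prepared certificate $C$ for $(v,k,\mathsf{hash}(\mathsf{log}[k]))$ in phase PREPREPARED: set $(\mathsf{prep\_log},\mathsf{prep\_view},\mathsf{cert})[k]\leftarrow(\mathsf{log}[k],v,C)$,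 the phase to PREPARED, and send $\mathtt{PRECOMMIT}(v,k,\mathsf{hash}(\mathsf{log}[k]))$ to all; - on a quorum of $\mathtt{PRECOMMIT}(v,k,\mathsf{hash}(\mathsf{prep\_log}[k]))$ in phase PREPARED: set $\mathsf{lock\_view}[k]\leftarrow v$, the phase to PRECOMMITTED, and send $\mathtt{COMMIT}(v,k,\mathsf{hash}(\mathsf{prep\_log}[k]))$ to all; - on a commit certificate $C$ for $(v,k,\mathsf{hash}(\mathsf{prep\_log}[k]))$ in phase PRECOMMITTED: set $\mathsf{commit\_log}[k]\leftarrow\mathsf{log}[k]$, the phase to COMMITTED, and send $\mathtt{DECISION}(\mathsf{commit\_log}[k],k,C)$ to all. - *Decisions.* On $\mathtt{DECISION}(x,k,C)$, where $C$ is a commit certificate for $(v,k,\mathsf{hash}(x))$ for some $v$, set $\mathsf{commit\_log}[k]\leftarrow x$. - *Delivery.* In normal status, when $\mathsf{commit\_log}[\mathsf{last\_delivered}+1]\neq\bot$: increment $\mathsf{last\_delivered}$, deliver $\mathsf{commit\_log}[\mathsf{last\_delivered}]$ unless it is $\mathtt{nop}$, and remove it from the queue; if now $\mathsf{last\_delivered}=\mathsf{curr\_view}\cdot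 B$, ask the synchronizer to advance and set the status to advanced. **Theorem.** Every execution of HotStuff-light has the following properties. 1. *(Ordering)* If a correct process $p$ delivers $x_1$ before $x_2$, then no correct process $q$ delivers $x_2$ before $x_1$. 2. *(Integrity)* Every correct process delivers a value at most once. 3. *(Committed values are stable)* If $\mathsf{committed}(C,v,k,\mathsf{hash}(x))$, $\mathsf{wf}(C)$ and $v'>v$, then - for all $C',x'$: $\mathsf{prepared}(C',v',k,\mathsf{hash}(x'))\wedge\mathsf{wf}(C')$ implies $x=x'$; - for all $C',k'$: $x\neq\mathtt{nop}\wedge\mathsf{prepared}(C',v',k',\mathsf{hash}(x))\wedge\mathsf{wf}(C')$ implies $k=k'$. -/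

import Mathlib

universe u w

namespace HotStuffLight

/-- The fixed data of the protocol: the fault threshold `f` (there are `3 f + 1` processes), the
number `B` of log slots allotted to each view, the hash function, the application's validity
predicate, the special value `nop`, and the set of correct processes; the others are Byzantine. -/
structure Setup (V : Type u) (H : Type w) where
  f : ℕ
  B : ℕ
  hash : V → H
  valid : V → Prop
  nop : V
  correct : Finset (Fin (3 * f + 1))

/-- Processes, numbered from `0`. -/
abbrev Proc (f : ℕ) : Type := Fin (3 * f + 1)

/-- The leader of view `v ≥ 1`: process number `(v - 1) mod n`, counting from `0`. -/
def leader (f v : ℕ) : Proc f :=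
  ⟨(v - 1) % (3 * f + 1), Nat.mod_lt _ (Nat.succ_pos _)⟩

/-- A quorum is a set of `2 f + 1` processes. -/
def IsQuorum {f : ℕ} (Q : Finset (Proc f)) : Prop := Q.card = 2 * f + 1

/-! ### Messages -/

inductive VoteKind
  | prepare
  | precommit
  | commit

/-- A signed message `⟨PREPARE(v, k, h)⟩_j`, `⟨PRECOMMIT(v, k, h)⟩_j` or `⟨COMMIT(v, k, h)⟩_j`.
Log positions are the positive integers. -/
structure Vote (f : ℕ) (H : Type w) where
  kind : VoteKind
  signer : Proc f
  view : ℕ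
  pos : ℕ+
  digest : H

/-- Certificates are sets of signed votes. -/
abbrev Cert (f : ℕ) (H : Type w) : Type w := Set (Vote f H)

/-- `C = {⟨T(v, k, h)⟩_j | p_j ∈ Q}` for a quorum `Q`, where `T` is the kind of vote. -/
def IsCert {f : ℕ} {H : Type w} (T : VoteKind) (C : Cert f H) (v : ℕ) (k : ℕ+) (h : H) : Prop :=
  ∃ Q : Finset (Proc f), IsQuorum Q ∧ C = {m | ∃ j ∈ Q, m = ⟨T, j, v, k, h⟩}

/-- `C` is a prepared certificate. -/
def prepared {f : ℕ} {H : Type w} (C : Cert f H) (v : ℕ) (k : ℕ+) (h : H) : Prop :=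
  IsCert VoteKind.prepare C v k h

/-- `C` is a commit certificate. -/
def committed {f : ℕ} {H : Type w} (C : Cert f H) (v : ℕ) (k : ℕ+) (h : H) : Prop :=
  IsCert VoteKind.commit C v k h

/-- Protocol messages; `src` is the process that sends (and signs) the message.  In arrays of
values, `none` stands for the empty entry `⊥`. -/
inductive Msg (f : ℕ) (V : Type u) (H : Type w)
  | broadcast (src : Proc f) (x : V)
  | preprepare (src : Proc f) (v : ℕ) (k : ℕ+) (x : V)
  | vote (m : Vote f H)
  | newLeader (src : Proc f) (v : ℕ) (prepView : ℕ+ → ℕ) (prepLog : ℕ+ → Option V)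
      (cert : ℕ+ → Cert f H)
  | newState (src : Proc f) (v : ℕ) (log : ℕ+ → Option V) (prepView : ℕ+ → ℕ)
      (cert : ℕ+ → Cert f H)
  | decision (src : Proc f) (x : V) (k : ℕ+) (C : Cert f H)

/-- The process that sends and signs a message. -/
def Msg.sender {f : ℕ} {V : Type u} {H : Type w} : Msg f V H → Proc f
  | .broadcast src _ => src
  | .preprepare src _ _ _ => src
  | .vote m => m.signer
  | .newLeader src _ _ _ _ => src
  | .newState src _ _ _ _ => src
  | .decision src _ _ _ => src

/-- The signed votes that are carried inside a message as part of a certificate. -/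
def Msg.carried {f : ℕ} {V : Type u} {H : Type w} : Msg f V H → Set (Vote f H)
  | .broadcast _ _ => ∅
  | .preprepare _ _ _ _ => ∅
  | .vote _ => ∅
  | .newLeader _ _ _ _ cert => ⋃ k, cert k
  | .newState _ _ _ _ cert => ⋃ k, cert k
  | .decision _ _ _ C => C

/-! ### Local states -/

inductive Status
  | initializing
  | normal
  | advanced

inductive Phase
  | start
  | preprepared
  | prepared
  | precommitted
  | committed

/-- The local state of a process.  The Boolean fields record which timers are running.  The
field `delivered` is the history of `deliver` events, in the order in which they occurred. -/
structure Local (f : ℕ) (V : Type u) (H : Type w) where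
  currView : ℕ
  status : Status
  queue : List V
  next : ℕ+
  log : ℕ+ → Option V
  phase : ℕ+ → Phase
  prepLog : ℕ+ → Option V
  prepView : ℕ+ → ℕ
  cert : ℕ+ → Cert f H
  lockView : ℕ+ → ℕ
  commitLog : ℕ+ → Option V
  lastDelivered : ℕ
  timerDelivery : Bool
  timerRecovery : Bool
  timerBroadcast : Bool
  delivered : List V

/-- The local state in which a process starts. -/
def Local.start (f : ℕ) (V : Type u) (H : Type w) : Local f V H where
  currView := 0
  status := Status.advanced
  queue := []
  next := 1
  log := fun _ => none
  phase := fun _ => Phase.start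
  prepLog := fun _ => none
  prepView := fun _ => 0
  cert := fun _ => ∅
  lockView := fun _ => 0
  commitLog := fun _ => none
  lastDelivered := 0
  timerDelivery := false
  timerRecovery := false
  timerBroadcast := false
  delivered := []

section Protocol

variable {V : Type u} {H : Type w}

def Local.stopAllTimers {f : ℕ} (s : Local f V H) : Local f V H :=
  { s with timerDelivery := false, timerRecovery := false, timerBroadcast := false }

/-- The state change of `propagate`; the slots of view `v` end at position `v * B`. -/
def Local.afterPropagate {f : ℕ} (B : ℕ) (s : Local f V H) : Local f V H :=
  { s with
    next := s.next + 1
    timerBroadcast := decide (((s.next + 1 : ℕ+) : ℕ) ≤ s.currView * B) }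

/-- The check made by a leader on a message `NEW_LEADER(v, prepView, prepLog, cert)`. -/
def ValidNewLeader (P : Setup V H) (v : ℕ) (prepView : ℕ+ → ℕ) (prepLog : ℕ+ → Option V)
    (cert : ℕ+ → Cert P.f H) : Prop :=
  ∀ k, 0 < prepView k →
    prepView k < v ∧ ∃ x, prepLog k = some x ∧ prepared (cert k) (prepView k) k (P.hash x)

/-- The check made by a process with lock views `lockView` on a message
`NEW_STATE(v, log, prepView, cert)` sent by `j`: the leader of `v` must propose a value at every
locked position, and every proposed value must come with a prepared certificate from a view that
precedes `v` and is not below the lock. -/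
def ValidNewState (P : Setup V H) (lockView : ℕ+ → ℕ) (j : Proc P.f) (v : ℕ)
    (log : ℕ+ → Option V) (prepView : ℕ+ → ℕ) (cert : ℕ+ → Cert P.f H) : Prop :=
  j = leader P.f v ∧
  (∀ k, 0 < lockView k → log k ≠ none) ∧
  (∀ k x, log k = some x →
    prepView k < v ∧ lockView k ≤ prepView k ∧ prepared (cert k) (prepView k) k (P.hash x))

/-- How the leader computes the contents of its `NEW_STATE` message from the `NEW_LEADER` messages
of the processes in `Q`: at each position it takes a value prepared in the highest view. -/
def Selects {f : ℕ} (Q : Finset (Proc f))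
    (pv : Proc f → ℕ+ → ℕ) (pl : Proc f → ℕ+ → Option V) (ct : Proc f → ℕ+ → Cert f H)
    (log' : ℕ+ → Option V) (prepView' : ℕ+ → ℕ) (cert' : ℕ+ → Cert f H) : Prop :=
  ∀ k,
    (∃ j' ∈ Q, pv j' k ≠ 0 ∧ (∀ j ∈ Q, pv j k ≤ pv j' k) ∧
      log' k = pl j' k ∧ prepView' k = pv j' k ∧ cert' k = ct j' k) ∨
    ((∀ j ∈ Q, pv j k = 0) ∧ log' k = none ∧ prepView' k = 0 ∧ cert' k = ∅)

open Classical in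
/-- The initial log of a view `v`, computed by a follower from the leader's proposal `log'`: among
the positions up to `bound = (v - 1) * B`, the empty ones, and those whose value also occurs at
another position with a higher prepared view, are filled with `nop`. -/
noncomputable def filterLog (nop : V) (bound : ℕ) (log' : ℕ+ → Option V) (prepView' : ℕ+ → ℕ) :
    ℕ+ → Option V :=
  fun k =>
    if (k : ℕ) ≤ bound ∧
        (log' k = none ∨ ∃ k', k' ≠ k ∧ log' k' = log' k ∧ prepView' k < prepView' k') then
      some nop
    else log' k

open Classical in
/-- The state change when a process whose next committed value is `x` delivers it. -/
noncomputable def Local.afterDeliver (P : Setup V H) (s : Local P.f V H) (x : V) :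
    Local P.f V H :=
  let s₁ : Local P.f V H :=
    { s with
      lastDelivered := s.lastDelivered + 1
      delivered := if x = P.nop then s.delivered else s.delivered ++ [x]
      queue := s.queue.filter (fun y => decide (y ≠ x)) }
  if s.lastDelivered + 1 = s.currView * P.B then
    { s₁.stopAllTimers with status := Status.advanced }
  else if (s.currView - 1) * P.B < s.lastDelivered + 1 then
    { s₁ with timerDelivery := true }
  else s₁

open Classical in
/-- The state change when a process in view `v` accepts `NEW_STATE(v, log', prepView', cert')`. -/
noncomputable def Local.afterNewState (P : Setup V H) (s : Local P.f V H)
    (log' : ℕ+ → Option V) (prepView' : ℕ+ → ℕ) : Local P.f V H :=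
  let s₁ : Local P.f V H :=
    { s with
      timerRecovery := false
      log := filterLog P.nop ((s.currView - 1) * P.B) log' prepView' }
  if s.currView * P.B ≤ s.lastDelivered then
    { s₁ with status := Status.advanced }
  else
    { s₁ with
      phase := fun k =>
        if (k : ℕ) ≤ (s.currView - 1) * P.B then Phase.preprepared else s.phase k
      timerDelivery := true
      status := Status.normal }

/-- The `PREPARE` messages that process `i` sends when it accepts a `NEW_STATE` message. -/
def newStateVotes (P : Setup V H) (i : Proc P.f) (s : Local P.f V H)
    (log' : ℕ+ → Option V) (prepView' : ℕ+ → ℕ) : Set (Msg P.f V H) :=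
  {m | s.lastDelivered < s.currView * P.B ∧
    ∃ k : ℕ+, (k : ℕ) ≤ (s.currView - 1) * P.B ∧
      ∃ x, filterLog P.nop ((s.currView - 1) * P.B) log' prepView' k = some x ∧
        m = Msg.vote ⟨VoteKind.prepare, i, s.currView, k, P.hash x⟩}

/-- `LocalStep P i sent s s' out`: the correct process `i`, in local state `s`, when the messages
sent so far are `sent`, may execute one handler of the protocol, moving to `s'` and sending the
messages `out`.  Any message that was sent may be received by any process at any time, any number
of times or never.  Timers have no durations: a running timer may expire at any time.  The
synchronizer may make a process enter any view higher than its current one at any time, so a call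
of `advance` has no effect on the state. -/
inductive LocalStep (P : Setup V H) (i : Proc P.f) (sent : Set (Msg P.f V H))
    (s : Local P.f V H) : Local P.f V H → Set (Msg P.f V H) → Prop
  /-- `timer_delivery` or `timer_recovery` expires. -/
  | timerExpires
      (active : s.timerDelivery = true ∨ s.timerRecovery = true) :
      LocalStep P i sent s { s.stopAllTimers with status := Status.advanced } ∅
  /-- The application calls `broadcast(x)`. -/
  | broadcast (x : V)
      (valid : P.valid x) :
      LocalStep P i sent s s {Msg.broadcast i x}
  /-- `BROADCAST(x)` is received. -/
  | receiveBroadcast (j : Proc P.f) (x : V)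
      (received : Msg.broadcast j x ∈ sent)
      (valid : P.valid x)
      (not_queued : x ∉ s.queue)
      (not_delivered : ∀ k : ℕ+, (k : ℕ) ≤ s.lastDelivered → s.commitLog k ≠ some x) :
      LocalStep P i sent s { s with queue := s.queue ++ [x] } ∅
  /-- The leader proposes the first value of its queue that is not in its log. -/
  | propose (x : V) (l₁ l₂ : List V)
      (normal : s.status = Status.normal)
      (is_leader : i = leader P.f s.currView)
      (slot : (s.next : ℕ) ≤ s.currView * P.B)
      (queue_eq : s.queue = l₁ ++ x :: l₂)
      (first : ∀ y ∈ l₁, ∃ k, s.log k = some y)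
      (not_in_log : ∀ k, s.log k ≠ some x) :
      LocalStep P i sent s (s.afterPropagate P.B) {Msg.preprepare i s.currView s.next x}
  /-- `timer_broadcast` expires. -/
  | timerBroadcastExpires
      (active : s.timerBroadcast = true) :
      LocalStep P i sent s (s.afterPropagate P.B) {Msg.preprepare i s.currView s.next P.nop}
  /-- A proposal is received from the leader; a value other than `nop` must be valid and new. -/
  | receivePreprepare (k : ℕ+) (x : V)
      (received : Msg.preprepare (leader P.f s.currView) s.currView k x ∈ sent)
      (normal : s.status = Status.normal)
      (phase : s.phase k = Phase.start)
      (slot : (k : ℕ) ≤ s.currView * P.B)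
      (acceptable : x = P.nop ∨ (P.valid x ∧ ∀ k', s.log k' ≠ some x)) :
      LocalStep P i sent s
        { s with
          log := Function.update s.log k (some x)
          phase := Function.update s.phase k Phase.preprepared }
        {Msg.vote ⟨VoteKind.prepare, i, s.currView, k, P.hash x⟩}
  /-- A quorum of `PREPARE` messages is received. -/
  | receivePrepares (k : ℕ+) (x : V) (C : Cert P.f H)
      (received : ∀ m ∈ C, Msg.vote m ∈ sent)
      (quorum : prepared C s.currView k (P.hash x))
      (phase : s.phase k = Phase.preprepared)
      (normal : s.status = Status.normal)
      (in_log : s.log k = some x) :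
      LocalStep P i sent s
        { s with
          prepLog := Function.update s.prepLog k (some x)
          prepView := Function.update s.prepView k s.currView
          cert := Function.update s.cert k C
          phase := Function.update s.phase k Phase.prepared }
        {Msg.vote ⟨VoteKind.precommit, i, s.currView, k, P.hash x⟩}
  /-- A quorum of `PRECOMMIT` messages is received: the process becomes locked. -/
  | receivePrecommits (k : ℕ+) (x : V) (C : Cert P.f H)
      (received : ∀ m ∈ C, Msg.vote m ∈ sent)
      (quorum : IsCert VoteKind.precommit C s.currView k (P.hash x))
      (phase : s.phase k = Phase.prepared)
      (normal : s.status = Status.normal)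
      (in_prepLog : s.prepLog k = some x) :
      LocalStep P i sent s
        { s with
          lockView := Function.update s.lockView k s.currView
          phase := Function.update s.phase k Phase.precommitted }
        {Msg.vote ⟨VoteKind.commit, i, s.currView, k, P.hash x⟩}
  /-- A quorum of `COMMIT` messages is received: the process commits `y = log[k]` and announces
  the decision. -/
  | receiveCommits (k : ℕ+) (x y : V) (C : Cert P.f H)
      (received : ∀ m ∈ C, Msg.vote m ∈ sent)
      (quorum : committed C s.currView k (P.hash x))
      (phase : s.phase k = Phase.precommitted)
      (normal : s.status = Status.normal)
      (in_prepLog : s.prepLog k = some x)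
      (in_log : s.log k = some y) :
      LocalStep P i sent s
        { s with
          commitLog := Function.update s.commitLog k (some y)
          phase := Function.update s.phase k Phase.committed }
        {Msg.decision i y k C}
  /-- The next committed value is delivered (unless it is `nop`). -/
  | deliver (x : V)
      (next_committed : s.commitLog (Nat.succPNat s.lastDelivered) = some x)
      (normal : s.status = Status.normal) :
      LocalStep P i sent s (s.afterDeliver P x) ∅
  /-- A decision with a commit certificate is received. -/
  | receiveDecision (j : Proc P.f) (x : V) (k : ℕ+) (C : Cert P.f H) (v : ℕ)
      (received : Msg.decision j x k C ∈ sent)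
      (certified : committed C v k (P.hash x)) :
      LocalStep P i sent s
        { s with commitLog := Function.update s.commitLog k (some x) } ∅
  /-- The synchronizer makes the process enter view `v`. -/
  | newView (v : ℕ)
      (higher : s.currView < v) :
      LocalStep P i sent s
        { s.stopAllTimers with
          currView := v
          status := Status.initializing
          timerRecovery := true }
        {Msg.newLeader i v s.prepView s.prepLog s.cert}
  /-- The leader of a view receives a quorum of valid `NEW_LEADER` messages. -/
  | receiveNewLeaders (Q : Finset (Proc P.f))
      (pv : Proc P.f → ℕ+ → ℕ) (pl : Proc P.f → ℕ+ → Option V) (ct : Proc P.f → ℕ+ → Cert P.f H)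
      (log' : ℕ+ → Option V) (prepView' : ℕ+ → ℕ) (cert' : ℕ+ → Cert P.f H)
      (is_leader : i = leader P.f s.currView)
      (initializing : s.status = Status.initializing)
      (quorum : IsQuorum Q)
      (received : ∀ j ∈ Q, Msg.newLeader j s.currView (pv j) (pl j) (ct j) ∈ sent)
      (valid : ∀ j ∈ Q, ValidNewLeader P s.currView (pv j) (pl j) (ct j))
      (selects : Selects Q pv pl ct log' prepView' cert') :
      LocalStep P i sent s
        { s with
          next := Nat.succPNat ((s.currView - 1) * P.B)
          timerBroadcast := true }
        {Msg.newState i s.currView log' prepView' cert'}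
  /-- A valid `NEW_STATE` message is received. -/
  | receiveNewState (j : Proc P.f) (log' : ℕ+ → Option V) (prepView' : ℕ+ → ℕ)
      (cert' : ℕ+ → Cert P.f H)
      (received : Msg.newState j s.currView log' prepView' cert' ∈ sent)
      (initializing : s.status = Status.initializing)
      (valid : ValidNewState P s.lockView j s.currView log' prepView' cert') :
      LocalStep P i sent s (s.afterNewState P log' prepView')
        (newStateVotes P i s log' prepView')

/-! ### Executions -/

/-- A global state: the local state of each process (meaningful for correct processes) and the
set of all messages sent so far. -/
structure Global (P : Setup V H) where
  loc : Proc P.f → Local P.f V H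
  sent : Set (Msg P.f V H)

/-- The initial global state. -/
def Global.start (P : Setup V H) : Global P where
  loc := fun _ => Local.start P.f V H
  sent := ∅

/-- `C` is well-formed: no signature of a correct process in it is forged, i.e. every vote in `C`
that bears the signature of a correct process was sent by that process. -/
def WF {P : Setup V H} (g : Global P) (C : Cert P.f H) : Prop :=
  ∀ m ∈ C, m.signer ∈ P.correct → Msg.vote m ∈ g.sent

/-- One step of the system: a correct process executes a handler, or a faulty process sends an
arbitrary message under its own name, which it can build without forging signatures of correct
processes. -/
inductive Step (P : Setup V H) : Global P → Global P → Prop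
  | correct (g : Global P) (i : Proc P.f) (s' : Local P.f V H) (out : Set (Msg P.f V H))
      (is_correct : i ∈ P.correct)
      (step : LocalStep P i g.sent (g.loc i) s' out) :
      Step P g ⟨Function.update g.loc i s', g.sent ∪ out⟩
  | byzantine (g : Global P) (m : Msg P.f V H)
      (is_faulty : m.sender ∉ P.correct)
      (unforged : WF g m.carried) :
      Step P g ⟨g.loc, insert m g.sent⟩

/-- The global states that occur in executions of the protocol. -/
def Reachable (P : Setup V H) (g : Global P) : Prop :=
  Relation.ReflTransGen (Step P) (Global.start P) g

/-! ### Properties of Byzantine atomic broadcast -/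

/-- `x₁` is delivered before `x₂`, where `l` is the sequence of delivered values. -/
def DeliversBefore (l : List V) (x₁ x₂ : V) : Prop :=
  ∃ a b : ℕ, a < b ∧ l[a]? = some x₁ ∧ l[b]? = some x₂

/-- Ordering: if a correct process delivers `x₁` before `x₂`, then no correct process delivers
`x₂` before `x₁`. -/
def Ordering (P : Setup V H) : Prop :=
  ∀ g, Reachable P g → ∀ p ∈ P.correct, ∀ q ∈ P.correct, ∀ x₁ x₂ : V,
    DeliversBefore (g.loc p).delivered x₁ x₂ → ¬ DeliversBefore (g.loc q).delivered x₂ x₁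

/-- Integrity: every correct process delivers a value at most once. -/
def Integrity (P : Setup V H) : Prop :=
  ∀ g, Reachable P g → ∀ p ∈ P.correct, (g.loc p).delivered.Nodup

/-- A value committed at position `k` in view `v` is the only one that can be prepared at `k` in
later views, and, unless it is `nop`, it is not prepared in later views at another position. -/
def CommittedStable (P : Setup V H) : Prop :=
  ∀ g, Reachable P g → ∀ (k : ℕ+) (v v' : ℕ) (C : Cert P.f H) (x : V),
    committed C v k (P.hash x) → WF g C → v < v' →
      (∀ (C' : Cert P.f H) (x' : V),
        prepared C' v' k (P.hash x') → WF g C' → x = x') ∧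
      (∀ (C' : Cert P.f H) (k' : ℕ+), x ≠ P.nop →
        prepared C' v' k' (P.hash x) → WF g C' → k = k')

end Protocol

end HotStuffLight

namespace HotStuffLight

variable {V : Type*} {H : Type*} {P : Setup V H}

/-! Safety rests on quorum intersection: two quorums share a correct process, so any two genuine
certificates expose two votes of one correct process. What such a process can have voted for is
recorded by `ViewLog`: its `PREPARE` votes of a view v come from a single log without repetitions
other than `nop`, whose positions up to (v-1)B stem from an accepted `NEW_STATE` message. Hence,
within one view, a position determines the value prepared there, and a value other than `nop`
determines its position.

Across views, `stable_of_committed` is a strong induction on v'. Let x be committed at k in v, and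
let something be prepared in v' > v. Some correct process voted `COMMIT` for x at k in v and
`PREPARE` in v'. Its lock forced the `NEW_STATE` message it accepted in v' to carry at k a value
prepared in a view u with v ≤ u < v'. This value is x, by uniqueness within v if u = v and by
induction if u > v. Removal of duplicates cannot erase x ≠ `nop`, since a copy elsewhere with a
higher prepared view would contradict the induction hypothesis. So the log of that process in v' has
x at k (`ViewLog.eq_of_commit`); being single-valued and free of repetitions, it yields both claims.

Committed values are therefore a function of the position, injective away from `nop`. Processes
deliver committed values position by position, skipping `nop`, so any two delivery sequences are
filtered prefixes of one sequence, which gives ordering and integrity.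

It remains to show that executions produce such logs. `LocalInv` ties votes to locks, phases and
logs, and is preserved by every step (`LocalInv.step`, `Inv.step`). Phases are not reset when a view
is entered, so the invariant tracks which positions may have left `START`: in normal status, a
position still in `START` has no vote in the current view and lies beyond the part filled by
`NEW_STATE`. -/

/-! ### Quorums and certificates -/

/-- No vote of a correct process in `C` is forged, where `sent` is the set of messages sent. -/
def Genuine (P : Setup V H) (sent : Set (Msg P.f V H)) (C : Cert P.f H) : Prop :=
  ∀ m ∈ C, m.signer ∈ P.correct → Msg.vote m ∈ sent

theorem Genuine.mono {sent sent' : Set (Msg P.f V H)} {C : Cert P.f H} (h : Genuine P sent C)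
    (hs : sent ⊆ sent') : Genuine P sent' C :=
  fun m hm hc => hs (h m hm hc)

theorem genuine_of_received {sent : Set (Msg P.f V H)} {C : Cert P.f H}
    (h : ∀ m ∈ C, Msg.vote m ∈ sent) : Genuine P sent C :=
  fun m hm _ => h m hm

/-- The overlap has at least 2(2f+1) - (3f+1) = f+1 members, more than there are faulty processes.
-/
theorem IsQuorum.exists_correct_inter (hf : (P.correctᶜ).card ≤ P.f) {Q Q' : Finset (Proc P.f)}
    (hQ : IsQuorum Q) (hQ' : IsQuorum Q') : ∃ p ∈ P.correct, p ∈ Q ∧ p ∈ Q' := by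
  by_contra! hcon
  have hsub : Q ∩ Q' ⊆ P.correctᶜ := by
    intro p hp
    rw [Finset.mem_inter] at hp
    rw [Finset.mem_compl]
    exact fun hc => hcon p hc hp.1 hp.2
  have h1 := Finset.card_le_card hsub
  have h2 := Finset.card_union_add_card_inter Q Q'
  have h3 := Finset.card_le_univ (Q ∪ Q')
  rw [Fintype.card_fin] at h3
  unfold IsQuorum at hQ hQ'
  omega

/-- The kinds, views and positions of the two certificates are independent, so this serves both
within a view and for a `COMMIT` quorum against a later `PREPARE` quorum. -/
theorem exists_correct_voter₂ (hf : (P.correctᶜ).card ≤ P.f) {sent : Set (Msg P.f V H)}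
    {T T' : VoteKind} {C C' : Cert P.f H} {v v' : ℕ} {k k' : ℕ+} {h h' : H}
    (hC : IsCert T C v k h) (hg : Genuine P sent C)
    (hC' : IsCert T' C' v' k' h') (hg' : Genuine P sent C') :
    ∃ p ∈ P.correct, Msg.vote ⟨T, p, v, k, h⟩ ∈ sent ∧ Msg.vote ⟨T', p, v', k', h'⟩ ∈ sent := by
  obtain ⟨Q, hQ, rfl⟩ := hC
  obtain ⟨Q', hQ', rfl⟩ := hC'
  obtain ⟨p, hp, h1, h2⟩ := hQ.exists_correct_inter hf hQ'
  exact ⟨p, hp, hg _ ⟨p, h1, rfl⟩ hp, hg' _ ⟨p, h2, rfl⟩ hp⟩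

theorem exists_correct_voter (hf : (P.correctᶜ).card ≤ P.f) {sent : Set (Msg P.f V H)}
    {T : VoteKind} {C : Cert P.f H} {v : ℕ} {k : ℕ+} {h : H}
    (hC : IsCert T C v k h) (hg : Genuine P sent C) :
    ∃ p ∈ P.correct, Msg.vote ⟨T, p, v, k, h⟩ ∈ sent := by
  obtain ⟨p, hp, h1, -⟩ := exists_correct_voter₂ hf hC hg hC hg
  exact ⟨p, hp, h1⟩

/-- Some genuine certificate shows that digest `h` was prepared at `k` in view `v`. -/
def PreparedIn (P : Setup V H) (sent : Set (Msg P.f V H)) (v : ℕ) (k : ℕ+) (h : H) : Prop :=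
  ∃ C : Cert P.f H, prepared C v k h ∧ Genuine P sent C

/-- Some genuine certificate shows that `x` was committed at `k`. -/
def CommittedAt (P : Setup V H) (sent : Set (Msg P.f V H)) (k : ℕ+) (x : V) : Prop :=
  ∃ (v : ℕ) (C : Cert P.f H), committed C v k (P.hash x) ∧ Genuine P sent C

theorem PreparedIn.mono {sent sent' : Set (Msg P.f V H)} {v : ℕ} {k : ℕ+} {h : H}
    (hp : PreparedIn P sent v k h) (hs : sent ⊆ sent') : PreparedIn P sent' v k h :=
  hp.imp fun _ hC => ⟨hC.1, hC.2.mono hs⟩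

theorem CommittedAt.mono {sent sent' : Set (Msg P.f V H)} {k : ℕ+} {x : V}
    (h : CommittedAt P sent k x) (hs : sent ⊆ sent') : CommittedAt P sent' k x :=
  h.imp fun _ h' => h'.imp fun _ hC => ⟨hC.1, hC.2.mono hs⟩

/-! ### What the votes of a correct process reveal -/

/-- `L` is the log in view `v` of process `p`: it contains every value for which `p` votes in `v`,
without repetitions, and it originates from a `NEW_STATE` message that respects the locks of
`p`. -/
structure ViewLog (P : Setup V H) (sent : Set (Msg P.f V H)) (p : Proc P.f) (v : ℕ)
    (L : ℕ+ → Option V) : Prop where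
  voted : ∀ k h, Msg.vote ⟨VoteKind.prepare, p, v, k, h⟩ ∈ sent → ∃ x, L k = some x ∧ P.hash x = h
  inj : ∀ k k' x, L k = some x → L k' = some x → x ≠ P.nop → k = k'
  origin : ∃ (log' : ℕ+ → Option V) (pv' : ℕ+ → ℕ),
    (∀ k : ℕ+, (k : ℕ) ≤ (v - 1) * P.B → L k = filterLog P.nop ((v - 1) * P.B) log' pv' k) ∧
    (∀ k x, log' k = some x → pv' k < v ∧ PreparedIn P sent (pv' k) k (P.hash x)) ∧
    (∀ u k h, Msg.vote ⟨VoteKind.commit, p, u, k, h⟩ ∈ sent → u < v → log' k ≠ none ∧ u ≤ pv' k)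

/-- New votes of `p` can only hurt through `PREPARE` in view `v` or `COMMIT` in a view below `v`;
later commits are harmless because `origin` looks only at earlier locks. -/
theorem ViewLog.mono {sent sent' : Set (Msg P.f V H)} {p : Proc P.f} {v : ℕ} {L : ℕ+ → Option V}
    (h : ViewLog P sent p v L) (hs : sent ⊆ sent')
    (hprep : ∀ k h, Msg.vote ⟨VoteKind.prepare, p, v, k, h⟩ ∈ sent' →
      Msg.vote ⟨VoteKind.prepare, p, v, k, h⟩ ∈ sent)
    (hcomm : ∀ u k h, u < v → Msg.vote ⟨VoteKind.commit, p, u, k, h⟩ ∈ sent' →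
      Msg.vote ⟨VoteKind.commit, p, u, k, h⟩ ∈ sent) : ViewLog P sent' p v L where
  voted k d hm := h.voted k d (hprep k d hm)
  inj := h.inj
  origin := by
    obtain ⟨log', pv', h1, h2, h3⟩ := h.origin
    exact ⟨log', pv', h1, fun k x hx => ⟨(h2 k x hx).1, (h2 k x hx).2.mono hs⟩,
      fun u k d hm hu => h3 u k d (hcomm u k d hu hm) hu⟩

/-- The properties of the votes of a correct process `p`. -/
structure VoteInv (P : Setup V H) (sent : Set (Msg P.f V H)) (p : Proc P.f) : Prop where
  one_le_view : ∀ v k h, Msg.vote ⟨VoteKind.prepare, p, v, k, h⟩ ∈ sent → 1 ≤ v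
  pos_le : ∀ v k h, Msg.vote ⟨VoteKind.prepare, p, v, k, h⟩ ∈ sent → (k : ℕ) ≤ v * P.B
  commit : ∀ v k h, Msg.vote ⟨VoteKind.commit, p, v, k, h⟩ ∈ sent → PreparedIn P sent v k h
  viewLog : ∀ v k h, Msg.vote ⟨VoteKind.prepare, p, v, k, h⟩ ∈ sent → ∃ L, ViewLog P sent p v L

/-! ### Uniqueness and stability of prepared and committed values -/

section Safety

variable (hinj : Function.Injective P.hash) (hf : (P.correctᶜ).card ≤ P.f)
  {sent : Set (Msg P.f V H)} (hvote : ∀ p ∈ P.correct, VoteInv P sent p)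
include hf hvote

theorem PreparedIn.bounds {v : ℕ} {k : ℕ+} {h : H} (hp : PreparedIn P sent v k h) :
    1 ≤ v ∧ (k : ℕ) ≤ v * P.B := by
  obtain ⟨C, hC, hg⟩ := hp
  obtain ⟨p, hp, hm⟩ := exists_correct_voter hf hC hg
  exact ⟨(hvote p hp).one_le_view _ _ _ hm, (hvote p hp).pos_le _ _ _ hm⟩

/-- A single correct signer suffices: it votes `COMMIT` only for a value it knows to be prepared. -/
theorem preparedIn_of_committed {v : ℕ} {k : ℕ+} {h : H} {C : Cert P.f H}
    (hC : committed C v k h) (hg : Genuine P sent C) : PreparedIn P sent v k h := by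
  obtain ⟨p, hp, hm⟩ := exists_correct_voter hf hC hg
  exact (hvote p hp).commit _ _ _ hm

include hinj

/-- In a view, at most one value is prepared at each position. -/
theorem PreparedIn.value_unique {v : ℕ} {k : ℕ+} {x x' : V}
    (h : PreparedIn P sent v k (P.hash x)) (h' : PreparedIn P sent v k (P.hash x')) : x = x' := by
  obtain ⟨C, hC, hg⟩ := h
  obtain ⟨C', hC', hg'⟩ := h'
  obtain ⟨p, hp, hm, hm'⟩ := exists_correct_voter₂ hf hC hg hC' hg'
  obtain ⟨L, hL⟩ := (hvote p hp).viewLog _ _ _ hm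
  obtain ⟨y, hy, hxy⟩ := hL.voted _ _ hm
  obtain ⟨y', hy', hxy'⟩ := hL.voted _ _ hm'
  rw [← hinj hxy, ← hinj hxy']
  exact Option.some_injective _ (hy.symm.trans hy')

/-- In a view, a value other than `nop` is prepared at most at one position. -/
theorem PreparedIn.pos_unique {v : ℕ} {k k' : ℕ+} {x : V} (hx : x ≠ P.nop)
    (h : PreparedIn P sent v k (P.hash x)) (h' : PreparedIn P sent v k' (P.hash x)) :
    k = k' := by
  obtain ⟨C, hC, hg⟩ := h
  obtain ⟨C', hC', hg'⟩ := h'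
  obtain ⟨p, hp, hm, hm'⟩ := exists_correct_voter₂ hf hC hg hC' hg'
  obtain ⟨L, hL⟩ := (hvote p hp).viewLog _ _ _ hm
  obtain ⟨y, hy, hxy⟩ := hL.voted _ _ hm
  obtain ⟨y', hy', hxy'⟩ := hL.voted _ _ hm'
  rw [hinj hxy] at hy
  rw [hinj hxy'] at hy'
  exact hL.inj _ _ _ hy hy' hx

/-- The log of a process in view `v'` contains a value that it voted to commit in an earlier
view, provided that this value is stable in the views in between. -/
theorem ViewLog.eq_of_commit {p : Proc P.f} {v v' : ℕ} {k : ℕ+} {x : V} {L : ℕ+ → Option V}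
    (hL : ViewLog P sent p v' L) (hvv : v < v') (hprep : PreparedIn P sent v k (P.hash x))
    (hm : Msg.vote ⟨VoteKind.commit, p, v, k, P.hash x⟩ ∈ sent)
    (ih : ∀ u, v < u → u < v' →
      (∀ x', PreparedIn P sent u k (P.hash x') → x = x') ∧
      (∀ k', x ≠ P.nop → PreparedIn P sent u k' (P.hash x) → k = k')) :
    L k = some x := by
  obtain ⟨log', pv', h1, h2, h3⟩ := hL.origin
  -- Slots of view v end at vB ≤ (v'-1)B, so `k` lies in the part of the log governed by
  -- `NEW_STATE`.
  have hk : (k : ℕ) ≤ (v' - 1) * P.B :=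
    (hprep.bounds hf hvote).2.trans (Nat.mul_le_mul_right _ (by omega))
  obtain ⟨hne, hle⟩ := h3 _ _ _ hm hvv
  obtain ⟨y, hy⟩ := Option.ne_none_iff_exists'.mp hne
  obtain ⟨hlt, hpy⟩ := h2 _ _ hy
  have hxy : x = y := by
    rcases hle.eq_or_lt with he | hl
    · rw [← he] at hpy
      exact hprep.value_unique hinj hf hvote hpy
    · exact (ih _ hl hlt).1 _ hpy
  subst hxy
  rw [h1 k hk]
  unfold filterLog
  -- Only a copy of `x` with a higher prepared view could displace it; that view lies strictly
  -- between `v` and `v'`, so the induction hypothesis excludes the copy. If `x` is `nop`,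
  -- displacement changes nothing.
  split_ifs with hc
  · obtain ⟨-, hc | ⟨k', hk', he, hpv⟩⟩ := hc
    · exact absurd hc hne
    · by_cases hnop : x = P.nop
      · rw [hnop]
      · obtain ⟨hlt', hpk'⟩ := h2 _ _ (he.trans hy)
        exact absurd ((ih _ (hle.trans_lt hpv) hlt').2 k' hnop hpk').symm hk'
  · exact hy

/-- A committed value is stable in later views. -/
theorem stable_of_committed {v : ℕ} {k : ℕ+} {x : V} {C : Cert P.f H}
    (hC : committed C v k (P.hash x)) (hg : Genuine P sent C) (v' : ℕ) (hvv : v < v') :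
    (∀ x', PreparedIn P sent v' k (P.hash x') → x = x') ∧
    (∀ k', x ≠ P.nop → PreparedIn P sent v' k' (P.hash x) → k = k') := by
  induction v' using Nat.strong_induction_on with
  | _ v' ih =>
    have hprep := preparedIn_of_committed hf hvote hC hg
    -- One log contains both the committed value and the newly prepared one; the two claims then
    -- follow from its being a function and from its injectivity.
    have key : ∀ k' x', PreparedIn P sent v' k' (P.hash x') →
        ∃ (p : Proc P.f) (L : ℕ+ → Option V),
          ViewLog P sent p v' L ∧ L k = some x ∧ L k' = some x' := by
      rintro k' x' ⟨C', hC', hg'⟩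
      obtain ⟨p, hp, hm, hm'⟩ := exists_correct_voter₂ hf hC hg hC' hg'
      obtain ⟨L, hL⟩ := (hvote p hp).viewLog _ _ _ hm'
      obtain ⟨y, hy, hxy⟩ := hL.voted _ _ hm'
      rw [hinj hxy] at hy
      exact ⟨p, L, hL, hL.eq_of_commit hinj hf hvote hvv hprep hm
        (fun u hu hu' => ih u hu' hu), hy⟩
    constructor
    · intro x' hx'
      obtain ⟨p, L, -, h1, h2⟩ := key _ _ hx'
      exact Option.some_injective _ (h1.symm.trans h2)
    · intro k' hnop hk'
      obtain ⟨p, L, hL, h1, h2⟩ := key _ _ hk'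
      exact hL.inj _ _ _ h1 h2 hnop

/-- A committed value is itself prepared, so stability applies from the earlier view to the later
one, and uniqueness within a view when the views coincide. -/
theorem CommittedAt.value_unique {k : ℕ+} {x x' : V}
    (h : CommittedAt P sent k x) (h' : CommittedAt P sent k x') : x = x' := by
  obtain ⟨v, C, hC, hg⟩ := h
  obtain ⟨v', C', hC', hg'⟩ := h'
  have hp := preparedIn_of_committed hf hvote hC hg
  have hp' := preparedIn_of_committed hf hvote hC' hg'
  rcases lt_trichotomy v v' with hlt | rfl | hlt
  · exact (stable_of_committed hinj hf hvote hC hg _ hlt).1 _ hp'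
  · exact hp.value_unique hinj hf hvote hp'
  · exact ((stable_of_committed hinj hf hvote hC' hg' _ hlt).1 _ hp).symm

theorem CommittedAt.pos_unique {k k' : ℕ+} {x : V} (hx : x ≠ P.nop)
    (h : CommittedAt P sent k x) (h' : CommittedAt P sent k' x) : k = k' := by
  obtain ⟨v, C, hC, hg⟩ := h
  obtain ⟨v', C', hC', hg'⟩ := h'
  have hp := preparedIn_of_committed hf hvote hC hg
  have hp' := preparedIn_of_committed hf hvote hC' hg'
  rcases lt_trichotomy v v' with hlt | rfl | hlt
  · exact (stable_of_committed hinj hf hvote hC hg _ hlt).2 _ hx hp'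
  · exact hp.pos_unique hinj hf hvote hx hp'
  · exact ((stable_of_committed hinj hf hvote hC' hg' _ hlt).2 _ hx hp).symm

end Safety

/-! ### Invariants of local states -/

open Classical in
/-- The invariant that relates the local state `s` of a correct process `p` to the messages
`sent` so far. -/
structure LocalInv (P : Setup V H) (sent : Set (Msg P.f V H)) (p : Proc P.f)
    (s : Local P.f V H) : Prop where
  votes : VoteInv P sent p
  prepare_le : ∀ v k h, Msg.vote ⟨VoteKind.prepare, p, v, k, h⟩ ∈ sent → v ≤ s.currView
  prepare_lt : s.status = Status.initializing →
    ∀ v k h, Msg.vote ⟨VoteKind.prepare, p, v, k, h⟩ ∈ sent → v < s.currView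
  one_le : s.status ≠ Status.advanced → 1 ≤ s.currView
  le_lock : ∀ v k h, Msg.vote ⟨VoteKind.commit, p, v, k, h⟩ ∈ sent → v ≤ s.lockView k
  lock_le : ∀ k, s.lockView k ≤ s.currView
  phase_le : ∀ k, s.phase k ≠ Phase.start → (k : ℕ) ≤ s.currView * P.B
  phase_init : s.status = Status.initializing →
    ∀ k, s.phase k ≠ Phase.start → (k : ℕ) ≤ (s.currView - 1) * P.B
  phase_ne : s.status = Status.normal →
    ∀ k : ℕ+, (k : ℕ) ≤ (s.currView - 1) * P.B → s.phase k ≠ Phase.start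
  phase_voted : s.status = Status.normal →
    ∀ k h, Msg.vote ⟨VoteKind.prepare, p, s.currView, k, h⟩ ∈ sent → s.phase k ≠ Phase.start
  viewLog : s.status = Status.normal → ViewLog P sent p s.currView s.log
  prepared : s.status = Status.normal →
    ∀ k, s.phase k ≠ Phase.start → s.phase k ≠ Phase.preprepared → ∀ x, s.prepLog k = some x →
      s.log k = some x ∧ PreparedIn P sent s.currView k (P.hash x)
  cert : ∀ k, Genuine P sent (s.cert k)
  committed : ∀ k x, s.commitLog k = some x → CommittedAt P sent k x
  delivered : ∃ l : List V, l.length = s.lastDelivered ∧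
    s.delivered = l.filter (fun y => decide (y ≠ P.nop)) ∧
    ∀ n x, l[n]? = some x → CommittedAt P sent (Nat.succPNat n) x

theorem localInv_start (p : Proc P.f) : LocalInv P ∅ p (Local.start P.f V H) where
  votes := ⟨by simp, by simp, by simp, by simp⟩
  prepare_le := by simp
  prepare_lt := by simp
  one_le h := absurd rfl h
  le_lock := by simp
  lock_le _ := le_rfl
  phase_le _ h := absurd rfl h
  phase_init h := by cases h
  phase_ne h := by cases h
  phase_voted h := by cases h
  viewLog h := by cases h
  prepared h := by cases h
  cert _ _ h := absurd h (Set.notMem_empty _)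
  committed _ _ h := by cases h
  delivered := ⟨[], rfl, rfl, by simp⟩

/-! ### Growth of the set of sent messages -/

section Mono

variable {sent sent' : Set (Msg P.f V H)} {p : Proc P.f} {s : Local P.f V H}

theorem VoteInv.add_prepare (h : VoteInv P sent p) (hs : sent ⊆ sent') {w : ℕ}
    {L : ℕ+ → Option V} (hL : ViewLog P sent' p w L)
    (hprep : ∀ v k d, Msg.vote ⟨VoteKind.prepare, p, v, k, d⟩ ∈ sent' →
      Msg.vote ⟨VoteKind.prepare, p, v, k, d⟩ ∈ sent ∨ v = w ∧ 1 ≤ w ∧ (k : ℕ) ≤ w * P.B)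
    (hcomm : ∀ v k d, Msg.vote ⟨VoteKind.commit, p, v, k, d⟩ ∈ sent' →
      Msg.vote ⟨VoteKind.commit, p, v, k, d⟩ ∈ sent) : VoteInv P sent' p where
  one_le_view v k d hm := by
    rcases hprep v k d hm with hm | ⟨rfl, h1, -⟩
    exacts [h.one_le_view _ _ _ hm, h1]
  pos_le v k d hm := by
    rcases hprep v k d hm with hm | ⟨rfl, -, h2⟩
    exacts [h.pos_le _ _ _ hm, h2]
  commit v k d hm := (h.commit _ _ _ (hcomm _ _ _ hm)).mono hs
  viewLog v k d hm := by
    by_cases hv : v = w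
    · exact ⟨L, hv ▸ hL⟩
    · obtain ⟨L', hL'⟩ := h.viewLog v k d ((hprep v k d hm).resolve_right fun hc => hv hc.1)
      exact ⟨L', hL'.mono hs
        (fun k d hm => (hprep v k d hm).resolve_right fun hc => hv hc.1)
        (fun u k d _ hm => hcomm u k d hm)⟩

/-- Only `PREPARE` and `COMMIT` votes signed by `p` are constrained by the invariant; all other
messages, including everything sent by other processes, merely enlarge the supply of certificates.
-/
theorem LocalInv.mono (h : LocalInv P sent p s) (hs : sent ⊆ sent')
    (hprep : ∀ v k d, Msg.vote ⟨VoteKind.prepare, p, v, k, d⟩ ∈ sent' →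
      Msg.vote ⟨VoteKind.prepare, p, v, k, d⟩ ∈ sent)
    (hcomm : ∀ v k d, Msg.vote ⟨VoteKind.commit, p, v, k, d⟩ ∈ sent' →
      Msg.vote ⟨VoteKind.commit, p, v, k, d⟩ ∈ sent) : LocalInv P sent' p s where
  votes :=
    { one_le_view := fun v k d hm => h.votes.one_le_view v k d (hprep _ _ _ hm)
      pos_le := fun v k d hm => h.votes.pos_le v k d (hprep _ _ _ hm)
      commit := fun v k d hm => (h.votes.commit v k d (hcomm _ _ _ hm)).mono hs
      viewLog := fun v k d hm => (h.votes.viewLog v k d (hprep _ _ _ hm)).imp fun _ hL =>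
        hL.mono hs (fun k d => hprep v k d) (fun u k d _ => hcomm u k d) }
  prepare_le v k d hm := h.prepare_le v k d (hprep _ _ _ hm)
  prepare_lt hi v k d hm := h.prepare_lt hi v k d (hprep _ _ _ hm)
  one_le := h.one_le
  le_lock v k d hm := h.le_lock v k d (hcomm _ _ _ hm)
  lock_le := h.lock_le
  phase_le := h.phase_le
  phase_init := h.phase_init
  phase_ne := h.phase_ne
  phase_voted hn k d hm := h.phase_voted hn k d (hprep _ _ _ hm)
  viewLog hn := (h.viewLog hn).mono hs (fun k d => hprep _ k d) (fun u k d _ => hcomm u k d)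
  prepared hn k h1 h2 x hx :=
    ⟨(h.prepared hn k h1 h2 x hx).1, (h.prepared hn k h1 h2 x hx).2.mono hs⟩
  cert k := (h.cert k).mono hs
  committed k x hx := (h.committed k x hx).mono hs
  delivered := by
    obtain ⟨l, h1, h2, h3⟩ := h.delivered
    exact ⟨l, h1, h2, fun n x hx => (h3 n x hx).mono hs⟩

end Mono

/-! ### Steps of correct processes preserve the invariant -/

section Steps

variable {sent : Set (Msg P.f V H)} {p : Proc P.f} {s : Local P.f V H}

theorem LocalInv.union (h : LocalInv P sent p s) {out : Set (Msg P.f V H)}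
    (hprep : ∀ v k d, Msg.vote ⟨VoteKind.prepare, p, v, k, d⟩ ∉ out)
    (hcomm : ∀ v k d, Msg.vote ⟨VoteKind.commit, p, v, k, d⟩ ∉ out) :
    LocalInv P (sent ∪ out) p s :=
  h.mono Set.subset_union_left (fun v k d hm => hm.resolve_right (hprep v k d))
    (fun v k d hm => hm.resolve_right (hcomm v k d))

/-- Changes of the queue, the timers, the next slot and the status `advanced` are harmless. -/
theorem LocalInv.of_eq (h : LocalInv P sent p s) {s' : Local P.f V H}
    (hstatus : s'.status = s.status ∨ s'.status = Status.advanced)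
    (h1 : s'.currView = s.currView) (h2 : s'.log = s.log) (h3 : s'.phase = s.phase)
    (h4 : s'.prepLog = s.prepLog) (h5 : s'.cert = s.cert) (h6 : s'.lockView = s.lockView)
    (h7 : s'.commitLog = s.commitLog) (h8 : s'.lastDelivered = s.lastDelivered)
    (h9 : s'.delivered = s.delivered) : LocalInv P sent p s' := by
  have hst : ∀ st, st ≠ Status.advanced → s'.status = st → s.status = st := by
    intro st hne he
    rcases hstatus with h | h
    · exact h ▸ he
    · exact absurd (he.symm.trans h) hne
  have hi := hst Status.initializing (by simp)
  have hn := hst Status.normal (by simp)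
  constructor <;> try simp only [h1, h2, h3, h4, h5, h6, h7, h8, h9]
  · exact h.votes
  · exact h.prepare_le
  · exact fun hs => h.prepare_lt (hi hs)
  · exact fun hs => h.one_le (fun hs' => hs (hstatus.elim (fun e => e.trans hs') id))
  · exact h.le_lock
  · exact h.lock_le
  · exact h.phase_le
  · exact fun hs => h.phase_init (hi hs)
  · exact fun hs => h.phase_ne (hn hs)
  · exact fun hs => h.phase_voted (hn hs)
  · exact fun hs => h.viewLog (hn hs)
  · exact fun hs => h.prepared (hn hs)
  · exact h.cert
  · exact h.committed
  · exact h.delivered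

theorem LocalInv.update_commitLog (h : LocalInv P sent p s) {k : ℕ+} {x : V}
    (hx : CommittedAt P sent k x) :
    LocalInv P sent p { s with commitLog := Function.update s.commitLog k (some x) } :=
  { h with
    committed := by
      intro k' x' he
      by_cases hk : k' = k
      · subst hk
        simp only [Function.update_self, Option.some.injEq] at he
        exact he ▸ hx
      · exact h.committed k' x' (by simpa [hk] using he) }

/-- The phase of a position may advance once its value is known to be prepared. -/
theorem LocalInv.update_phase (h : LocalInv P sent p s) {k : ℕ+} {ph : Phase}
    (hstart : s.phase k ≠ Phase.start) (hph : ph ≠ Phase.start)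
    (hprep : s.status = Status.normal → ∀ x, s.prepLog k = some x →
      s.log k = some x ∧ PreparedIn P sent s.currView k (P.hash x)) :
    LocalInv P sent p { s with phase := Function.update s.phase k ph } := by
  have hne : ∀ k', Function.update s.phase k ph k' ≠ Phase.start → s.phase k' ≠ Phase.start := by
    intro k' hk'
    by_cases hk : k' = k
    · exact hk ▸ hstart
    · simpa [hk] using hk'
  have hne' : ∀ k', s.phase k' ≠ Phase.start → Function.update s.phase k ph k' ≠ Phase.start := by
    intro k' hk'
    by_cases hk : k' = k
    · subst hk; simpa using hph
    · simpa [hk] using hk'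
  exact
    { h with
      phase_le := fun k' hk' => h.phase_le k' (hne k' hk')
      phase_init := fun hi k' hk' => h.phase_init hi k' (hne k' hk')
      phase_ne := fun hn k' hk' => hne' k' (h.phase_ne hn k' hk')
      phase_voted := fun hn k' d hm => hne' k' (h.phase_voted hn k' d hm)
      prepared := by
        intro hn k' h1 h2 x hx
        by_cases hk : k' = k
        · subst hk
          exact hprep hn x hx
        · exact h.prepared hn k' (hne k' h1) (by simpa [hk] using h2) x hx }

/-- The entries are overwritten while the phase is still `preprepared`, where the clause `prepared`
says nothing about `k`; the phase advances afterwards. -/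
theorem LocalInv.receivePrepares (h : LocalInv P sent p s) {k : ℕ+} {x : V} {C : Cert P.f H}
    (received : ∀ m ∈ C, Msg.vote m ∈ sent)
    (quorum : HotStuffLight.prepared C s.currView k (P.hash x))
    (phase : s.phase k = Phase.preprepared) (in_log : s.log k = some x) :
    LocalInv P sent p
      { s with
        prepLog := Function.update s.prepLog k (some x)
        prepView := Function.update s.prepView k s.currView
        cert := Function.update s.cert k C
        phase := Function.update s.phase k Phase.prepared } := by
  have h' : LocalInv P sent p
      { s with
        prepLog := Function.update s.prepLog k (some x)
        prepView := Function.update s.prepView k s.currView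
        cert := Function.update s.cert k C } :=
    { h with
      prepared := by
        intro hn k' h1 h2 y hy
        by_cases hk : k' = k
        · subst hk
          exact absurd phase h2
        · exact h.prepared hn k' h1 h2 y (by simpa [hk] using hy)
      cert := by
        intro k'
        by_cases hk : k' = k
        · subst hk
          simpa using genuine_of_received received
        · simpa [hk] using h.cert k' }
  refine h'.update_phase (by simp [phase]) (by simp) fun _ y hy => ?_
  simp only [Function.update_self, Option.some.injEq] at hy
  subst hy
  exact ⟨in_log, C, quorum, genuine_of_received received⟩

/-- Lock and vote must change together, since locks bound the views of all `COMMIT` votes from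
above. Existing view logs survive because the new vote is in the current view, hence not below the
view of any of them. -/
theorem LocalInv.add_commit (h : LocalInv P sent p s) {k : ℕ+} {x : V}
    (hprep : PreparedIn P sent s.currView k (P.hash x)) :
    LocalInv P (sent ∪ {Msg.vote ⟨VoteKind.commit, p, s.currView, k, P.hash x⟩}) p
      { s with lockView := Function.update s.lockView k s.currView } := by
  set sent' := sent ∪ {Msg.vote ⟨VoteKind.commit, p, s.currView, k, P.hash x⟩} with hsent
  have hs : sent ⊆ sent' := Set.subset_union_left
  have hp : ∀ v k d, Msg.vote ⟨VoteKind.prepare, p, v, k, d⟩ ∈ sent' →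
      Msg.vote ⟨VoteKind.prepare, p, v, k, d⟩ ∈ sent := by
    simp [hsent]
  have hc : ∀ v k' d, Msg.vote ⟨VoteKind.commit, p, v, k', d⟩ ∈ sent' →
      Msg.vote ⟨VoteKind.commit, p, v, k', d⟩ ∈ sent ∨
        v = s.currView ∧ k' = k ∧ d = P.hash x := by
    simp [hsent, or_comm]
  have hold : ∀ v L, v ≤ s.currView → ViewLog P sent p v L → ViewLog P sent' p v L :=
    fun v L hv hL => hL.mono hs (fun k d => hp v k d)
      (fun u k d hu hm => (hc u k d hm).resolve_right fun he => by omega)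
  exact
    { votes :=
        { one_le_view := fun v k d hm => h.votes.one_le_view v k d (hp _ _ _ hm)
          pos_le := fun v k d hm => h.votes.pos_le v k d (hp _ _ _ hm)
          commit := by
            intro v k' d hm
            rcases hc _ _ _ hm with hm | ⟨rfl, rfl, rfl⟩
            · exact (h.votes.commit _ _ _ hm).mono hs
            · exact hprep.mono hs
          viewLog := fun v k d hm => (h.votes.viewLog v k d (hp _ _ _ hm)).imp fun L hL =>
            hold v L (h.prepare_le v k d (hp _ _ _ hm)) hL }
      prepare_le := fun v k d hm => h.prepare_le v k d (hp _ _ _ hm)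
      prepare_lt := fun hi v k d hm => h.prepare_lt hi v k d (hp _ _ _ hm)
      one_le := h.one_le
      le_lock := by
        intro v k' d hm
        rcases hc _ _ _ hm with hm | ⟨rfl, rfl, rfl⟩
        · have := h.le_lock v k' d hm
          by_cases hk : k' = k
          · subst hk
            simpa using this.trans (h.lock_le k')
          · simpa [hk] using this
        · simp
      lock_le := by
        intro k'
        by_cases hk : k' = k
        · subst hk; simp
        · simpa [hk] using h.lock_le k'
      phase_le := h.phase_le
      phase_init := h.phase_init
      phase_ne := h.phase_ne
      phase_voted := fun hn k d hm => h.phase_voted hn k d (hp _ _ _ hm)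
      viewLog := fun hn => hold _ _ le_rfl (h.viewLog hn)
      prepared := fun hn k h1 h2 x hx =>
        ⟨(h.prepared hn k h1 h2 x hx).1, (h.prepared hn k h1 h2 x hx).2.mono hs⟩
      cert := fun k => (h.cert k).mono hs
      committed := fun k x hx => (h.committed k x hx).mono hs
      delivered := by
        obtain ⟨l, h1, h2, h3⟩ := h.delivered
        exact ⟨l, h1, h2, fun n x hx => (h3 n x hx).mono hs⟩ }

theorem LocalInv.receivePreprepare (h : LocalInv P sent p s) {k : ℕ+} {x : V}
    (normal : s.status = Status.normal) (phase : s.phase k = Phase.start)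
    (slot : (k : ℕ) ≤ s.currView * P.B)
    (acceptable : x = P.nop ∨ ∀ k', s.log k' ≠ some x) :
    LocalInv P (sent ∪ {Msg.vote ⟨VoteKind.prepare, p, s.currView, k, P.hash x⟩}) p
      { s with
        log := Function.update s.log k (some x)
        phase := Function.update s.phase k Phase.preprepared } := by
  set sent' := sent ∪ {Msg.vote ⟨VoteKind.prepare, p, s.currView, k, P.hash x⟩} with hsent
  have hs : sent ⊆ sent' := Set.subset_union_left
  have hp : ∀ v k' d, Msg.vote ⟨VoteKind.prepare, p, v, k', d⟩ ∈ sent' →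
      Msg.vote ⟨VoteKind.prepare, p, v, k', d⟩ ∈ sent ∨
        v = s.currView ∧ k' = k ∧ d = P.hash x := by
    simp [hsent, or_comm]
  have hc : ∀ v k d, Msg.vote ⟨VoteKind.commit, p, v, k, d⟩ ∈ sent' →
      Msg.vote ⟨VoteKind.commit, p, v, k, d⟩ ∈ sent := by
    simp [hsent]
  have hone := h.one_le (by simp [normal])
  have hL := h.viewLog normal
  have hL' : ViewLog P sent' p s.currView (Function.update s.log k (some x)) :=
    { voted := by
        intro k' d hm'
        rcases hp _ _ _ hm' with hm | ⟨-, rfl, rfl⟩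
        -- A position already voted for in this view has left `START`, so its log entry is not
        -- overwritten.
        · have hk : k' ≠ k := by
            rintro rfl
            exact h.phase_voted normal _ _ hm phase
          simpa [hk] using hL.voted _ _ hm
        · exact ⟨x, by simp⟩
      inj := by
        intro k₁ k₂ y h1 h2 hy
        by_cases hk₁ : k₁ = k <;> by_cases hk₂ : k₂ = k
        · rw [hk₁, hk₂]
        · subst hk₁
          simp only [Function.update_self, Option.some.injEq] at h1
          rw [Function.update_of_ne hk₂] at h2
          subst h1
          exact absurd h2 (acceptable.resolve_left hy _)
        · subst hk₂
          simp only [Function.update_self, Option.some.injEq] at h2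
          rw [Function.update_of_ne hk₁] at h1
          subst h2
          exact absurd h1 (acceptable.resolve_left hy _)
        · rw [Function.update_of_ne hk₁] at h1
          rw [Function.update_of_ne hk₂] at h2
          exact hL.inj _ _ _ h1 h2 hy
      origin := by
        obtain ⟨log', pv', h1, h2, h3⟩ := hL.origin
        refine ⟨log', pv', ?_, fun k x hx => ⟨(h2 k x hx).1, (h2 k x hx).2.mono hs⟩,
          fun u k d hm => h3 u k d (hc u k d hm)⟩
        intro k' hk'
        -- Positions inherited from `NEW_STATE` have left `START`, so a proposal never alters them.
        have hk : k' ≠ k := by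
          rintro rfl
          exact h.phase_ne normal _ hk' phase
        simpa [hk] using h1 k' hk' }
  have hne' : ∀ k', s.phase k' ≠ Phase.start →
      Function.update s.phase k Phase.preprepared k' ≠ Phase.start := by
    intro k' hk'
    by_cases hk : k' = k
    · subst hk; simp
    · simpa [hk] using hk'
  exact
    { votes := h.votes.add_prepare hs hL'
        (fun v k' d hm => (hp v k' d hm).imp id fun ⟨h1, h2, _⟩ => ⟨h1, hone, h2 ▸ slot⟩) hc
      prepare_le := by
        intro v k' d hm
        rcases hp _ _ _ hm with hm | ⟨rfl, -, -⟩
        exacts [h.prepare_le _ _ _ hm, le_rfl]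
      prepare_lt := fun hi => by simp [normal] at hi
      one_le := h.one_le
      le_lock := fun v k d hm => h.le_lock v k d (hc _ _ _ hm)
      lock_le := h.lock_le
      phase_le := by
        intro k' hk'
        by_cases hk : k' = k
        · exact hk ▸ slot
        · exact h.phase_le k' (by simpa [hk] using hk')
      phase_init := fun hi => by simp [normal] at hi
      phase_ne := fun hn k' hk' => hne' k' (h.phase_ne hn k' hk')
      phase_voted := by
        intro hn k' d hm
        rcases hp _ _ _ hm with hm | ⟨-, rfl, -⟩
        · exact hne' k' (h.phase_voted hn _ _ hm)
        · simp
      viewLog := fun _ => hL'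
      prepared := by
        intro hn k' h1 h2 y hy
        by_cases hk : k' = k
        · subst hk
          simp at h2
        · have := h.prepared hn k' (by simpa [hk] using h1) (by simpa [hk] using h2) y hy
          exact ⟨by simpa [hk] using this.1, this.2.mono hs⟩
      cert := fun k => (h.cert k).mono hs
      committed := fun k x hx => (h.committed k x hx).mono hs
      delivered := by
        obtain ⟨l, h1, h2, h3⟩ := h.delivered
        exact ⟨l, h1, h2, fun n x hx => (h3 n x hx).mono hs⟩ }

theorem LocalInv.newView (h : LocalInv P sent p s) {v : ℕ} (higher : s.currView < v) :
    LocalInv P sent p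
      { s.stopAllTimers with
        currView := v
        status := Status.initializing
        timerRecovery := true } where
  votes := h.votes
  prepare_le w k d hm := (h.prepare_le w k d hm).trans higher.le
  prepare_lt _ w k d hm := (h.prepare_le w k d hm).trans_lt higher
  one_le _ := by dsimp; omega
  le_lock := h.le_lock
  lock_le k := (h.lock_le k).trans higher.le
  phase_le k hk := (h.phase_le k hk).trans (Nat.mul_le_mul_right _ higher.le)
  -- Old phases persist, but they concern slots of views up to the old one, all at most (v-1)B.
  phase_init _ k hk := (h.phase_le k hk).trans (Nat.mul_le_mul_right _ (by dsimp; omega))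
  phase_ne hn := by cases hn
  phase_voted hn := by cases hn
  viewLog hn := by cases hn
  prepared hn := by cases hn
  cert := h.cert
  committed := h.committed
  delivered := h.delivered

theorem LocalInv.deliver (h : LocalInv P sent p s) {x : V}
    (next_committed : s.commitLog (Nat.succPNat s.lastDelivered) = some x) :
    LocalInv P sent p (s.afterDeliver P x) := by
  classical
  have h' : LocalInv P sent p
      { s with
        lastDelivered := s.lastDelivered + 1
        delivered := if x = P.nop then s.delivered else s.delivered ++ [x] } :=
    { h with
      delivered := by
        obtain ⟨l, h1, h2, h3⟩ := h.delivered
        -- The witness list keeps `nop` entries, so that index n always corresponds to log position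
        -- n+1.
        refine ⟨l ++ [x], by simp [h1], ?_, ?_⟩
        · simp only [List.filter_append, h2]
          split_ifs with hx <;> simp [hx]
        · intro n y hy
          rcases lt_or_ge n l.length with hn | hn
          · rw [List.getElem?_append_left hn] at hy
            exact h3 n y hy
          · rw [List.getElem?_append_right hn] at hy
            obtain ⟨hlt, he⟩ := List.getElem?_eq_some_iff.mp hy
            have hn' : n = s.lastDelivered := by
              simp at hlt
              omega
            simp at he
            subst he hn'
            exact h.committed _ _ next_committed }
  unfold Local.afterDeliver
  split_ifs
  all_goals
    refine h'.of_eq ?_ rfl rfl rfl rfl rfl rfl rfl rfl ?_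
    · first | exact Or.inl rfl | exact Or.inr rfl
    · simp [Local.stopAllTimers, *]

end Steps

/-! ### Accepting the initial log of a view -/

section NewState

variable {sent : Set (Msg P.f V H)} {p : Proc P.f} {s : Local P.f V H}

theorem filterLog_eq_some {nop x : V} (hx : x ≠ nop) {b : ℕ} {log' : ℕ+ → Option V}
    {pv' : ℕ+ → ℕ} {k : ℕ+} (h : filterLog nop b log' pv' k = some x) :
    log' k = some x ∧
      ((k : ℕ) ≤ b → ∀ k', k' ≠ k → log' k' = log' k → pv' k' ≤ pv' k) := by
  unfold filterLog at h
  split_ifs at h with hc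
  · exact absurd (Option.some_injective _ h).symm hx
  · refine ⟨h, fun hk k' hk' he => ?_⟩
    by_contra! hlt
    exact hc ⟨hk, Or.inr ⟨k', hk', he, hlt⟩⟩

/-- The initial log of a view has no repetitions. -/
theorem filterLog_inj (hinj : Function.Injective P.hash) (hf : (P.correctᶜ).card ≤ P.f)
    (hvote : ∀ p ∈ P.correct, VoteInv P sent p) {v : ℕ} {log' : ℕ+ → Option V} {pv' : ℕ+ → ℕ}
    (hlog : ∀ k x, log' k = some x → pv' k < v ∧ PreparedIn P sent (pv' k) k (P.hash x))
    {k k' : ℕ+} {x : V} (hx : x ≠ P.nop)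
    (h : filterLog P.nop ((v - 1) * P.B) log' pv' k = some x)
    (h' : filterLog P.nop ((v - 1) * P.B) log' pv' k' = some x) : k = k' := by
  obtain ⟨h1, h2⟩ := filterLog_eq_some hx h
  obtain ⟨h1', h2'⟩ := filterLog_eq_some hx h'
  -- Every certified entry was prepared before `v`, so it lies in the range where duplicates are
  -- removed.
  have hb : ∀ k x, log' k = some x → (k : ℕ) ≤ (v - 1) * P.B := fun k x hk =>
    ((hlog k x hk).2.bounds hf hvote).2.trans
      (Nat.mul_le_mul_right _ (by have := (hlog k x hk).1; omega))
  by_contra hne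
  -- If both copies survive, neither prepared view exceeds the other; they are equal, and uniqueness
  -- within that view applies.
  have e1 := h2 (hb _ _ h1) k' (Ne.symm hne) (h1'.trans h1.symm)
  have e2 := h2' (hb _ _ h1') k hne (h1.trans h1'.symm)
  have hp' := (hlog _ _ h1').2
  rw [e1.antisymm e2] at hp'
  exact hne ((hlog _ _ h1).2.pos_unique hinj hf hvote hx hp')

/-- The log may be arbitrary here: the invariant constrains it only in normal status. -/
theorem LocalInv.newState_advanced (h : LocalInv P sent p s) (L : ℕ+ → Option V) :
    LocalInv P sent p
      { s with timerRecovery := false, log := L, status := Status.advanced } where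
  votes := h.votes
  prepare_le := h.prepare_le
  prepare_lt hi := by cases hi
  one_le hi := absurd rfl hi
  le_lock := h.le_lock
  lock_le := h.lock_le
  phase_le := h.phase_le
  phase_init hi := by cases hi
  phase_ne hi := by cases hi
  phase_voted hi := by cases hi
  viewLog hi := by cases hi
  prepared hi := by cases hi
  cert := h.cert
  committed := h.committed
  delivered := h.delivered

/-- Here locks become a constraint on the new log: each earlier `COMMIT` of `p` is bounded by a
lock, and the check on `NEW_STATE` bounds the lock by a certified prepared view. -/
theorem LocalInv.newState_normal (hinj : Function.Injective P.hash)
    (hf : (P.correctᶜ).card ≤ P.f) (hvote : ∀ p ∈ P.correct, VoteInv P sent p)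
    (h : LocalInv P sent p s) (initializing : s.status = Status.initializing)
    {log' : ℕ+ → Option V} {pv' : ℕ+ → ℕ} {out : Set (Msg P.f V H)}
    (hlock : ∀ k, 0 < s.lockView k → log' k ≠ none)
    (hlog : ∀ k x, log' k = some x →
      pv' k < s.currView ∧ s.lockView k ≤ pv' k ∧ PreparedIn P sent (pv' k) k (P.hash x))
    (hout : ∀ m, Msg.vote m ∈ out → ∃ (k : ℕ+) (x : V), (k : ℕ) ≤ (s.currView - 1) * P.B ∧
      filterLog P.nop ((s.currView - 1) * P.B) log' pv' k = some x ∧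
      m = ⟨VoteKind.prepare, p, s.currView, k, P.hash x⟩) :
    LocalInv P (sent ∪ out) p
      { s with
        timerRecovery := false
        log := filterLog P.nop ((s.currView - 1) * P.B) log' pv'
        phase := fun k =>
          if (k : ℕ) ≤ (s.currView - 1) * P.B then Phase.preprepared else s.phase k
        timerDelivery := true
        status := Status.normal } := by
  have hs : sent ⊆ sent ∪ out := Set.subset_union_left
  have hone := h.one_le (by simp [initializing])
  have hslot : (s.currView - 1) * P.B ≤ s.currView * P.B := Nat.mul_le_mul_right _ (by omega)
  have hprep : ∀ v k d, Msg.vote ⟨VoteKind.prepare, p, v, k, d⟩ ∈ sent ∪ out →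
      Msg.vote ⟨VoteKind.prepare, p, v, k, d⟩ ∈ sent ∨ v = s.currView ∧
        (k : ℕ) ≤ (s.currView - 1) * P.B ∧
        ∃ x, filterLog P.nop ((s.currView - 1) * P.B) log' pv' k = some x ∧ P.hash x = d := by
    rintro v k d (hm | hm)
    · exact Or.inl hm
    · obtain ⟨k, x, hk, hx, he⟩ := hout _ hm
      cases he
      exact Or.inr ⟨rfl, hk, x, hx, rfl⟩
  have hcomm : ∀ v k d, Msg.vote ⟨VoteKind.commit, p, v, k, d⟩ ∈ sent ∪ out →
      Msg.vote ⟨VoteKind.commit, p, v, k, d⟩ ∈ sent := by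
    rintro v k d (hm | hm)
    · exact hm
    · obtain ⟨k, x, hk, hx, he⟩ := hout _ hm
      cases he
  have hcurr : ∀ k d, Msg.vote ⟨VoteKind.prepare, p, s.currView, k, d⟩ ∈ sent ∪ out →
      (k : ℕ) ≤ (s.currView - 1) * P.B ∧
        ∃ x, filterLog P.nop ((s.currView - 1) * P.B) log' pv' k = some x ∧ P.hash x = d := by
    intro k d hm
    rcases hprep _ _ _ hm with hm | ⟨-, h1⟩
    -- An initializing process has not yet voted in its view, so the votes in `out` are its only
    -- ones there.
    · exact absurd (h.prepare_lt initializing _ _ _ hm) (lt_irrefl _)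
    · exact h1
  have hL : ViewLog P (sent ∪ out) p s.currView
      (filterLog P.nop ((s.currView - 1) * P.B) log' pv') :=
    { voted := fun k d hm => (hcurr k d hm).2
      inj := fun k k' x h1 h2 hx => filterLog_inj hinj hf hvote
        (fun k x hk => ⟨(hlog k x hk).1, (hlog k x hk).2.2⟩) hx h1 h2
      origin := by
        refine ⟨log', pv', fun k _ => rfl,
          fun k x hk => ⟨(hlog k x hk).1, (hlog k x hk).2.2.mono hs⟩, fun u k d hm _ => ?_⟩
        have hm' := hcomm _ _ _ hm
        -- Views of commits are at least 1, so the lock is nonzero and not mistaken for the default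
        -- value 0.
        have h1 := ((h.votes.commit _ _ _ hm').bounds hf hvote).1
        have h2 := h.le_lock _ _ _ hm'
        have hne := hlock k (by omega)
        obtain ⟨x, hx⟩ := Option.ne_none_iff_exists'.mp hne
        exact ⟨hne, h2.trans (hlog _ _ hx).2.1⟩ }
  exact
    { votes := h.votes.add_prepare hs hL
        (fun v k d hm => (hprep v k d hm).imp id fun ⟨h1, h2, _⟩ =>
          ⟨h1, hone, h2.trans hslot⟩) hcomm
      prepare_le := by
        intro v k d hm
        rcases hprep _ _ _ hm with hm | ⟨rfl, -⟩
        exacts [h.prepare_le _ _ _ hm, le_rfl]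
      prepare_lt := fun hi => by cases hi
      one_le := fun _ => hone
      le_lock := fun v k d hm => h.le_lock v k d (hcomm _ _ _ hm)
      lock_le := h.lock_le
      phase_le := by
        intro k hk
        dsimp only at hk
        split_ifs at hk with hk'
        · exact hk'.trans hslot
        · exact h.phase_le k hk
      phase_init := fun hi => by cases hi
      phase_ne := fun _ k hk => by simp [hk]
      phase_voted := fun _ k d hm => by simp [(hcurr k d hm).1]
      viewLog := fun _ => hL
      -- Vacuous: inherited positions are reset to `preprepared`, and all others are still in
      -- `START`.
      prepared := by
        intro _ k h1 h2
        dsimp only at h1 h2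
        split_ifs at h1 h2 with hk
        · exact absurd rfl h2
        · exact absurd (h.phase_init initializing k h1) hk
      cert := fun k => (h.cert k).mono hs
      committed := fun k x hx => (h.committed k x hx).mono hs
      delivered := by
        obtain ⟨l, h1, h2, h3⟩ := h.delivered
        exact ⟨l, h1, h2, fun n x hx => (h3 n x hx).mono hs⟩ }

theorem LocalInv.receiveNewState (hinj : Function.Injective P.hash)
    (hf : (P.correctᶜ).card ≤ P.f) (hvote : ∀ p ∈ P.correct, VoteInv P sent p)
    (h : LocalInv P sent p s) (initializing : s.status = Status.initializing)
    {j : Proc P.f} {log' : ℕ+ → Option V} {pv' : ℕ+ → ℕ} {cert' : ℕ+ → Cert P.f H}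
    (hcert : ∀ k, Genuine P sent (cert' k))
    (valid : ValidNewState P s.lockView j s.currView log' pv' cert') :
    LocalInv P (sent ∪ newStateVotes P p s log' pv') p (s.afterNewState P log' pv') := by
  obtain ⟨-, hlock, hlog⟩ := valid
  unfold Local.afterNewState
  dsimp only
  split_ifs with hle
  · have hempty : newStateVotes P p s log' pv' = ∅ := by
      ext m
      simp only [newStateVotes, Set.mem_ofPred_eq, Set.mem_empty_iff_false, iff_false]
      exact fun hm => absurd hm.1 (not_lt.mpr hle)
    rw [hempty, Set.union_empty]
    exact h.newState_advanced _
  · refine h.newState_normal hinj hf hvote initializing hlock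
      (fun k x hk => ⟨(hlog k x hk).1, (hlog k x hk).2.1, cert' k, (hlog k x hk).2.2, hcert k⟩) ?_
    rintro m ⟨-, k, hk, x, hx, he⟩
    exact ⟨k, x, hk, hx, Msg.vote.inj he⟩

end NewState

/-! ### The global invariant -/

/-- A correct process that sends `m` neither impersonates others nor relays forged votes. -/
theorem LocalStep.sender_carried {sent : Set (Msg P.f V H)} {p : Proc P.f} {s s' : Local P.f V H}
    {out : Set (Msg P.f V H)} (hcarried : ∀ m ∈ sent, Genuine P sent m.carried)
    (h : LocalInv P sent p s) (hstep : LocalStep P p sent s s' out) :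
    ∀ m ∈ out, m.sender = p ∧ Genuine P sent m.carried := by
  have hempty : Genuine P sent (∅ : Cert P.f H) := fun m hm => absurd hm (Set.notMem_empty _)
  cases hstep with
  | timerExpires | receiveBroadcast | deliver | receiveDecision =>
    intro m hm
    exact absurd hm (Set.notMem_empty _)
  | broadcast | propose | timerBroadcastExpires | receivePreprepare | receivePrepares
  | receivePrecommits =>
    rintro m rfl
    exact ⟨rfl, hempty⟩
  | receiveCommits k x y C received =>
    rintro m rfl
    exact ⟨rfl, genuine_of_received received⟩
  | newView =>
    rintro m rfl
    refine ⟨rfl, fun m hm => ?_⟩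
    obtain ⟨k, hk⟩ := Set.mem_iUnion.mp hm
    exact h.cert k m hk
  | receiveNewLeaders Q pv pl ct log' pv' cert' _ _ _ received _ selects =>
    rintro m rfl
    refine ⟨rfl, fun m hm => ?_⟩
    obtain ⟨k, hk⟩ := Set.mem_iUnion.mp hm
    rcases selects k with ⟨j, hj, -, -, -, -, he⟩ | ⟨-, -, -, he⟩
    · exact hcarried _ (received j hj) m (Set.mem_iUnion.mpr ⟨k, he ▸ hk⟩)
    · exact absurd (he ▸ hk) (Set.notMem_empty _)
  | receiveNewState j log' pv' cert' =>
    rintro m ⟨-, k, -, x, -, rfl⟩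
    exact ⟨rfl, hempty⟩

theorem LocalInv.step (hinj : Function.Injective P.hash) (hf : (P.correctᶜ).card ≤ P.f)
    {sent : Set (Msg P.f V H)} (hvote : ∀ p ∈ P.correct, VoteInv P sent p)
    (hcarried : ∀ m ∈ sent, Genuine P sent m.carried) {p : Proc P.f}
    {s s' : Local P.f V H} {out : Set (Msg P.f V H)}
    (h : LocalInv P sent p s) (hstep : LocalStep P p sent s s' out) :
    LocalInv P (sent ∪ out) p s' := by
  cases hstep with
  | timerExpires =>
    exact (h.union (by simp) (by simp)).of_eq (Or.inr rfl) rfl rfl rfl rfl rfl rfl rfl rfl rfl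
  | broadcast => exact h.union (by simp) (by simp)
  | receiveBroadcast | propose | timerBroadcastExpires | receiveNewLeaders =>
    exact (h.union (by simp) (by simp)).of_eq (Or.inl rfl) rfl rfl rfl rfl rfl rfl rfl rfl rfl
  | receivePreprepare k x _ normal phase slot acceptable =>
    exact h.receivePreprepare normal phase slot (acceptable.imp id And.right)
  | receivePrepares k x C received quorum phase _ in_log =>
    exact (h.receivePrepares received quorum phase in_log).union (by simp) (by simp)
  | receivePrecommits k x C received quorum phase normal in_prepLog =>
    have hprep := h.prepared normal k (by simp [phase]) (by simp [phase])
    have h' := h.add_commit (hprep x in_prepLog).2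
    exact h'.update_phase (by simp [phase]) (by simp)
      fun _ y hy => ⟨(hprep y hy).1, (hprep y hy).2.mono Set.subset_union_left⟩
  | receiveCommits k x y C received quorum phase normal in_prepLog in_log =>
    have hprep := h.prepared normal k (by simp [phase]) (by simp [phase])
    -- The certificate speaks of `prepLog`, the decision of `log`; past phase `preprepared` the two
    -- agree.
    have hxy : x = y :=
      Option.some_injective _ ((hprep x in_prepLog).1.symm.trans in_log)
    subst hxy
    have h' := h.update_commitLog ⟨_, C, quorum, genuine_of_received received⟩
    exact (h'.update_phase (k := k) (ph := Phase.committed) (by simp [phase]) (by simp)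
      fun _ => hprep).union (by simp) (by simp)
  | deliver x next_committed => exact (h.deliver next_committed).union (by simp) (by simp)
  | receiveDecision j x k C v received certified =>
    exact (h.update_commitLog ⟨v, C, certified, hcarried _ received⟩).union (by simp) (by simp)
  | newView v higher => exact (h.newView higher).union (by simp) (by simp)
  | receiveNewState j log' pv' cert' received initializing valid =>
    refine h.receiveNewState hinj hf hvote initializing (fun k m hm => ?_) valid
    exact hcarried _ received m (Set.mem_iUnion.mpr ⟨k, hm⟩)

/-- The invariant of global states. -/
structure Inv (P : Setup V H) (g : Global P) : Prop where
  carried : ∀ m ∈ g.sent, Genuine P g.sent m.carried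
  loc : ∀ p ∈ P.correct, LocalInv P g.sent p (g.loc p)

theorem Inv.step (hinj : Function.Injective P.hash) (hf : (P.correctᶜ).card ≤ P.f)
    {g g' : Global P} (h : Inv P g) (hstep : Step P g g') : Inv P g' := by
  cases hstep with
  | correct i s' out hi hloc =>
    have hout := hloc.sender_carried h.carried (h.loc i hi)
    refine ⟨?_, fun p hp => ?_⟩
    · rintro m (hm | hm)
      · exact (h.carried m hm).mono Set.subset_union_left
      · exact (hout m hm).2.mono Set.subset_union_left
    · by_cases hpi : p = i
      · subst hpi
        simpa using (h.loc p hp).step hinj hf (fun q hq => (h.loc q hq).votes) h.carried hloc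
      -- Messages sent by `i` bear its own name, so no vote of `p` is added.
      · simpa [hpi] using (h.loc p hp).union (fun v k d hm => hpi (hout _ hm).1)
          (fun v k d hm => hpi (hout _ hm).1)
  | byzantine m hm hg =>
    have hs : g.sent ⊆ insert m g.sent := Set.subset_insert _ _
    refine ⟨?_, fun p hp => (h.loc p hp).mono hs ?_ ?_⟩
    · rintro m' (rfl | hm')
      · exact Genuine.mono hg hs
      · exact (h.carried m' hm').mono hs
    all_goals
      rintro v k d (rfl | hm')
      · exact absurd hp hm
      · exact hm'

theorem Inv.of_reachable (hinj : Function.Injective P.hash) (hf : (P.correctᶜ).card ≤ P.f)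
    {g : Global P} (h : Reachable P g) : Inv P g := by
  induction h with
  | refl => exact ⟨fun m hm => absurd hm (Set.notMem_empty _), fun p _ => localInv_start p⟩
  | tail _ hstep ih => exact ih.step hinj hf hstep

/-! ### Delivered sequences -/

/-- A sequence of values such that the `n`-th one is committed at position `n`. -/
def CommittedSeq (P : Setup V H) (sent : Set (Msg P.f V H)) (l : List V) : Prop :=
  ∀ n x, l[n]? = some x → CommittedAt P sent (Nat.succPNat n) x

theorem nodup_filter_of_pos_unique {l : List V} {q : V → Bool}
    (h : ∀ (i j : ℕ) (x : V), q x → l[i]? = some x → l[j]? = some x → i = j) : (l.filter q).Nodup := by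
  have hp : l.Pairwise fun a b => q a → a ≠ b := by
    rw [List.pairwise_iff_getElem]
    intro i j hi hj hij hq he
    have := h i j _ hq (List.getElem?_eq_getElem hi) (by rw [List.getElem?_eq_getElem hj, he])
    omega
  refine (hp.filter q).imp_of_mem ?_
  intro a b ha _ hab
  exact hab (List.mem_filter.mp ha).2

section Deliveries

variable (hinj : Function.Injective P.hash) (hf : (P.correctᶜ).card ≤ P.f)
  {sent : Set (Msg P.f V H)} (hvote : ∀ p ∈ P.correct, VoteInv P sent p)
include hinj hf hvote

open Classical in
theorem CommittedSeq.nodup {l : List V} (h : CommittedSeq P sent l) :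
    (l.filter fun y => decide (y ≠ P.nop)).Nodup := by
  refine nodup_filter_of_pos_unique fun i j x hx hi hj => ?_
  have := (h i x hi).pos_unique hinj hf hvote (by simpa using hx) (h j x hj)
  exact Nat.succPNat_injective this

/-- Both sequences list the unique committed value at each position, so only their lengths can
differ. -/
theorem CommittedSeq.prefix {l l' : List V} (h : CommittedSeq P sent l)
    (h' : CommittedSeq P sent l') (hle : l.length ≤ l'.length) : l <+: l' := by
  rw [List.prefix_iff_getElem]
  refine ⟨hle, fun i hi => ?_⟩
  exact (h i _ (List.getElem?_eq_getElem hi)).value_unique hinj hf hvote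
    (h' i _ (List.getElem?_eq_getElem (hi.trans_le hle)))

end Deliveries

theorem DeliversBefore.of_prefix {l l' : List V} {x y : V} (h : DeliversBefore l x y)
    (hl : l <+: l') : DeliversBefore l' x y := by
  obtain ⟨t, rfl⟩ := hl
  obtain ⟨a, b, hab, ha, hb⟩ := h
  have hlt : ∀ {i : ℕ} {z : V}, l[i]? = some z → (l ++ t)[i]? = some z := fun {i z} hi => by
    rw [List.getElem?_append_left (List.getElem?_eq_some_iff.mp hi).1, hi]
  exact ⟨a, b, hab, hlt ha, hlt hb⟩

theorem DeliversBefore.asymm {l : List V} (hl : l.Nodup) {x y : V} (h : DeliversBefore l x y) :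
    ¬ DeliversBefore l y x := by
  obtain ⟨a, b, hab, ha, hb⟩ := h
  rintro ⟨c, d, hcd, hc, hd⟩
  have hlt := fun {i : ℕ} {z : V} (hi : l[i]? = some z) => (List.getElem?_eq_some_iff.mp hi).1
  have had := (List.getElem?_inj (hlt ha) hl).mp (ha.trans hd.symm)
  have hbc := (List.getElem?_inj (hlt hb) hl).mp (hb.trans hc.symm)
  omega

end HotStuffLight

open HotStuffLight in
theorem mainTheorem10 {V : Type*} {H : Type*} (P : HotStuffLight.Setup V H)
    (hash_injective : Function.Injective P.hash)
    (faulty_le : (P.correctᶜ).card ≤ P.f) :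
    HotStuffLight.Ordering P ∧ HotStuffLight.Integrity P ∧
      HotStuffLight.CommittedStable P := by
  refine ⟨fun g hg p hp q hq x₁ x₂ h₁ h₂ => ?_, fun g hg p hp => ?_,
    fun g hg k v v' C x hC hw hvv => ?_⟩
  all_goals
    have hI := Inv.of_reachable hash_injective faulty_le hg
    have hvote := fun p hp => (hI.loc p hp).votes
  · obtain ⟨l, -, hd, hl⟩ := (hI.loc p hp).delivered
    obtain ⟨l', -, hd', hl'⟩ := (hI.loc q hq).delivered
    rw [hd] at h₁
    rw [hd'] at h₂
    -- Filtering preserves prefixes, so both orders would occur in the longer delivery sequence,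
    -- which has no repetitions.
    rcases le_total l.length l'.length with hle | hle
    · exact (h₁.of_prefix ((CommittedSeq.prefix hash_injective faulty_le hvote hl hl' hle).filter
        _)).asymm (CommittedSeq.nodup hash_injective faulty_le hvote hl') h₂
    · exact h₁.asymm (CommittedSeq.nodup hash_injective faulty_le hvote hl)
        (h₂.of_prefix ((CommittedSeq.prefix hash_injective faulty_le hvote hl' hl hle).filter _))
  · obtain ⟨l, -, hd, hl⟩ := (hI.loc p hp).delivered
    rw [hd]
    exact CommittedSeq.nodup hash_injective faulty_le hvote hl
  · obtain ⟨h1, h2⟩ := stable_of_committed hash_injective faulty_le hvote hC hw v' hvv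
    exact ⟨fun C' x' hC' hw' => h1 x' ⟨C', hC', hw'⟩,
      fun C' k' hx hC' hw' => h2 k' hx ⟨C', hC', hw'⟩⟩
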